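/- Let $\mathbb{P}$ be a countable set of propositional variables. The formulas of dynamic probability logic over $\mathbb{P}$ are given by the grammar $$\varphi ::= p \mid \neg\varphi \mid \varphi\wedge\varphi \mid L_r\varphi \mid \bigcirc\varphi \qquad (p\in\mathbb{P},\ r\in\mathbb{Q}\cap[0,1]);$$ the connectives $\to,\leftrightarrow$ and $\bot$ are the usual abbreviations, $\bigcirc^0\varphi=\varphi$ and $\bigcirc^{n+1}\varphi=\bigcirc\bigcirc^{n}\varphi$. *Semantics.* A dynamic Markov process $\langle\Omega,\mathcal{A},T,f\rangle$ consists of a measurable space $\langle\Omega,\mathcal{A}\rangle$, a Markov kernel $T:\Omega\times\mathcal{A}\to[0,1]$ (each $T(w,\cdot)$ is a probability measure on $\mathcal A$ and each $T(\cdot,A)$, $A\in\mathcal{A}$, is measurable) and a measurable map $f:\Omega\to\Omega$. A model $\mathfrak{M}$ based on it adds a valuation $v:\mathbb{P}\to\mathcal{A}$. Satisfaction at $w\in\Omega$ is defined by: $w\vDash p$ iff $w\in v(p)$; $\neg$ and $\wedge$ are interpreted classically; $w\vDash L_r\varphi$ iff $T(w,\{x\in\Omega : x\vDash\varphi\})\ge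 r$; $w\vDash\bigcirc\varphi$ iff $f(w)\vDash\varphi$. A formula $\varphi$ is valid, $\vDash\varphi$, if it is satisfied at every $w\in\Omega$ in every model based on every dynamic Markov process. *Proof system.* The axioms of $\mathcal{H}^-_{\mathsf{DPL}}$ are all instances of the following, for formulas $\varphi,\psi$ and $r,s\in\mathbb{Q}\cap[0,1]$: - all propositional tautologies; - $L_0\bot$; - $L_r\neg\varphi\to\neg L_s\varphi$, if $r+s>1$; - $L_r(\varphi\wedge\psi)\wedge L_s(\varphi\wedge\neg\psi)\to L_{r+s}\varphi$, if $r+s\le 1$; - $\neg L_r(\varphi\wedge\psi)\wedge\neg L_s(\varphi\wedge\neg\psi)\to\neg L_{r+s}\varphi$, if $r+s\le 1$; - $L_1(\varphi\to\psi)\to(L_r\varphi\to L_r\psi)$; - $\bigcirc\neg\varphi\leftrightarrow\neg\bigcirc\varphi$; - $\bigcirc(\varphi\wedge\psi)\leftrightarrow(\bigcirc\varphi\wedge\bigcirc\psi)$. The rules are: modus ponens (from $\varphi\to\psi$ and $\varphi$ infer $\psi$); the infinitary Archimedean rule (from all $\psi\to\bigcirc^nL_s\varphi$ with $s\in\mathbb{Q}\cap[0,1]$,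 $s<r$, infer $\psi\to\bigcirc^nL_r\varphi$, for every $n\in\mathbb{N}$ and $r\in\mathbb{Q}\cap[0,1]$); and necessitation (from $\varphi$ infer $L_1\varphi$; from $\varphi$ infer $\bigcirc\varphi$). A formula $\varphi$ is derivable, $\vdash\varphi$, if there are a countable (finite or infinite) ordinal $\alpha$ and a sequence of formulas $(\varphi_\beta)_{\beta\le\alpha+1}$ with $\varphi_{\alpha+1}=\varphi$ in which every $\varphi_\beta$ is an axiom or follows by one of the rules from (possibly infinitely many) preceding formulas. **Theorem (weak completeness).** For every formula $\varphi$, if $\vDash\varphi$ then $\vdash\varphi$. -/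

import Mathlib

universe u v

namespace DPL

/-- Admissible indices of the probability operators: the rationals in `[0, 1]`. -/
abbrev Idx : Type := Set.Icc (0 : ℚ) 1

/-- The sum of two indices, when it is at most `1`. -/
def Idx.add (r s : Idx) (h : (r : ℚ) + (s : ℚ) ≤ 1) : Idx :=
  ⟨(r : ℚ) + (s : ℚ), add_nonneg r.2.1 s.2.1, h⟩

/-- Formulas of dynamic probability logic over the propositional variables `P`. -/
inductive Formula (P : Type*) where
  | var (p : P) : Formula P
  | neg (φ : Formula P) : Formula P
  | and (φ ψ : Formula P) : Formula P
  | L (r : Idx) (φ : Formula P) : Formula P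
  | next (φ : Formula P) : Formula P

namespace Formula

variable {P : Type*}

/-- `φ → ψ`, as an abbreviation. -/
def imp (φ ψ : Formula P) : Formula P := neg (and φ (neg ψ))

/-- `φ ↔ ψ`, as an abbreviation. -/
def iff (φ ψ : Formula P) : Formula P := and (imp φ ψ) (imp ψ φ)

/-- `⊥`, as the abbreviation `p ∧ ¬p` for a propositional variable `p`. -/
def bot (p : P) : Formula P := and (var p) (neg (var p))

/-- `○ⁿ φ`, with `○⁰ φ = φ`. -/
def nextIter (n : ℕ) (φ : Formula P) : Formula P := next^[n] φ

/-- Evaluation of a formula as a propositional combination of variables, `L`-formulas and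
`○`-formulas, the latter being assigned truth values arbitrarily by `e`. -/
def propEval (e : Formula P → Prop) : Formula P → Prop
  | var p => e (var p)
  | neg φ => ¬ propEval e φ
  | and φ ψ => propEval e φ ∧ propEval e ψ
  | L r φ => e (L r φ)
  | next φ => e (next φ)

/-- `φ` is (a substitution instance of) a propositional tautology. -/
def IsTautology (φ : Formula P) : Prop := ∀ e : Formula P → Prop, propEval e φ

end Formula

section Semantics

/-- A dynamic Markov process on the measurable space `Ω`: a Markov kernel `T` on `Ω` together
with a measurable self-map `f` of `Ω`. -/
structure DynamicMarkovProcess (Ω : Type*) [MeasurableSpace Ω] where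
  T : ProbabilityTheory.Kernel Ω Ω
  isMarkovKernel : ProbabilityTheory.IsMarkovKernel T
  f : Ω → Ω
  measurable_f : Measurable f

/-- A dynamic Markov model: a dynamic Markov process with a valuation of the propositional
variables by measurable sets. -/
structure DynamicMarkovModel (P Ω : Type*) [MeasurableSpace Ω] where
  process : DynamicMarkovProcess Ω
  v : P → Set Ω
  measurableSet_v : ∀ p, MeasurableSet (v p)

variable {P Ω : Type*} [MeasurableSpace Ω]

/-- The satisfaction relation `𝔐, w ⊨ φ`. -/
def Sat (M : DynamicMarkovModel P Ω) : Formula P → Ω → Prop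
  | .var p, w => w ∈ M.v p
  | .neg φ, w => ¬ Sat M φ w
  | .and φ ψ, w => Sat M φ w ∧ Sat M ψ w
  | .L r φ, w => ((r : ℚ) : ℝ) ≤ (M.process.T w).real {x | Sat M φ x}
  | .next φ, w => Sat M φ (M.process.f w)

/-- The truth set of every formula is measurable, so that its probability is meaningful. -/
theorem measurableSet_sat (M : DynamicMarkovModel P Ω) (φ : Formula P) :
    MeasurableSet {w | Sat M φ w} := by
  induction φ with
  | var p => exact M.measurableSet_v p
  | neg φ ih => exact ih.compl
  | and φ ψ ih₁ ih₂ => exact ih₁.inter ih₂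
  | L r φ ih =>
    exact measurableSet_le measurable_const
      (ProbabilityTheory.Kernel.measurable_coe M.process.T ih).ennreal_toReal
  | next φ ih => exact M.process.measurable_f ih

/-- Validity in a model. -/
def ValidInModel (M : DynamicMarkovModel P Ω) (φ : Formula P) : Prop := ∀ w, Sat M φ w

/-- Validity in a dynamic Markov process: validity in every model based on it. -/
def ValidInProcess (F : DynamicMarkovProcess Ω) (φ : Formula P) : Prop :=
  ∀ M : DynamicMarkovModel P Ω, M.process = F → ValidInModel M φ

end Semantics

/-- `⊨ φ`: validity in the class of all dynamic Markov processes. -/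
def Valid {P : Type u} (φ : Formula P) : Prop :=
  ∀ (Ω : Type v) [MeasurableSpace Ω] (F : DynamicMarkovProcess Ω), ValidInProcess F φ

section ProofSystem

open Formula

variable {P : Type*}

/-- The axiom schemes. -/
inductive IsAxiom : Formula P → Prop
  | taut (φ : Formula P) (h : IsTautology φ) : IsAxiom φ
  | fa₁ (p : P) : IsAxiom (L 0 (bot p))
  | fa₂ (r s : Idx) (φ : Formula P) (h : 1 < (r : ℚ) + (s : ℚ)) :
      IsAxiom (imp (L r (neg φ)) (neg (L s φ)))
  | fa₃ (r s : Idx) (φ ψ : Formula P) (h : (r : ℚ) + (s : ℚ) ≤ 1) :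
      IsAxiom (imp (and (L r (and φ ψ)) (L s (and φ (neg ψ)))) (L (Idx.add r s h) φ))
  | fa₄ (r s : Idx) (φ ψ : Formula P) (h : (r : ℚ) + (s : ℚ) ≤ 1) :
      IsAxiom (imp (and (neg (L r (and φ ψ))) (neg (L s (and φ (neg ψ)))))
        (neg (L (Idx.add r s h) φ)))
  | mono (r : Idx) (φ ψ : Formula P) :
      IsAxiom (imp (L 1 (imp φ ψ)) (imp (L r φ) (L r ψ)))
  | func_next (φ : Formula P) : IsAxiom (iff (next (neg φ)) (neg (next φ)))
  | conj_next (φ ψ : Formula P) :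
      IsAxiom (iff (next (and φ ψ)) (and (next φ) (next ψ)))

/-- The inference rules: `IsRule Γ χ` says that `χ` is the conclusion of an application of a
rule whose set of premises is `Γ`. -/
inductive IsRule : Set (Formula P) → Formula P → Prop
  | mp (φ ψ : Formula P) : IsRule {imp φ ψ, φ} ψ
  | arch (n : ℕ) (r : Idx) (φ ψ : Formula P) :
      IsRule {χ | ∃ s : Idx, s < r ∧ χ = imp ψ (nextIter n (L s φ))}
        (imp ψ (nextIter n (L r φ)))
  | nec_L (φ : Formula P) : IsRule {φ} (L 1 φ)
  | nec_next (φ : Formula P) : IsRule {φ} (next φ)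

/-- The sequence `s 0, s 1, …, s (α + 1)` of formulas is a derivation of `φ`: it ends in `φ`, and
each entry is an axiom or follows by a rule from premises that occur earlier in the sequence.
(The values of `s` beyond `α + 1` play no role.) -/
def IsDerivation (α : Ordinal.{0}) (s : Ordinal.{0} → Formula P) (φ : Formula P) : Prop :=
  s (α + 1) = φ ∧
    ∀ β ≤ α + 1, IsAxiom (s β) ∨ ∃ Γ : Set (Formula P), Γ ⊆ s '' Set.Iio β ∧ IsRule Γ (s β)

/-- `⊢ φ`: there is a derivation of `φ` of countable (possibly infinite) length. -/
def Derivable (φ : Formula P) : Prop :=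
  ∃ (α : Ordinal.{0}) (s : Ordinal.{0} → Formula P),
    α.card ≤ Cardinal.aleph0 ∧ IsDerivation α s φ

end ProofSystem

end DPL

/-! A formula in every world (a maximal consistent set closed under the Archimedean rule) is
provable, by a Rasiowa–Sikorski argument: there are only countably many formulas, hence countably
many requirements to meet, and a generic ideal of consistent formulas meets them all
(`exists_world_mem`).

It remains to see that a valid φ lies in every world. At a world w, the supremum of the r with `L r
χ` in w behaves as a finitely additive probability of χ (`prob_and_add_prob_and_neg`), and the
supremum is attained (`L_mem_iff`). No countably additive extension to all formulas is needed: φ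
mentions the probabilities of finitely many formulas only, and these are realised by a finite sum of
point masses (`exists_measure_relative`). The worlds thus form a model with the full σ-algebra in
which membership is truth for φ (`sat_canonicalModel_iff`).

Finally, inductive provability yields a derivation of countable length (`Provable.derivable`). -/

namespace DPL

open Formula MeasureTheory

variable {P : Type*}

/-! ### Countability of the set of formulas. -/

section Countability

/-- A Gödel numbering of formulas. -/
def Formula.code [Encodable P] : Formula P → ℕ
  | .var p => Nat.pair 0 (Encodable.encode p)
  | .neg φ => Nat.pair 1 φ.code
  | .and φ ψ => Nat.pair 2 (Nat.pair φ.code ψ.code)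
  | .L r φ => Nat.pair 3 (Nat.pair (Encodable.encode r) φ.code)
  | .next φ => Nat.pair 4 φ.code

theorem Formula.code_injective [Encodable P] :
    Function.Injective (Formula.code : Formula P → ℕ) := by
  intro φ
  induction φ with
  | var p => intro ψ h; cases ψ <;> simp_all [Formula.code, Nat.pair_eq_pair]
  | neg φ ih =>
    intro ψ h
    cases ψ <;> simp only [Formula.code, Nat.pair_eq_pair] at h <;> try omega
    rw [ih h.2]
  | and φ₁ φ₂ ih₁ ih₂ =>
    intro ψ h
    cases ψ <;> simp only [Formula.code, Nat.pair_eq_pair] at h <;> try omega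
    rw [ih₁ h.2.1, ih₂ h.2.2]
  | L r φ ih =>
    intro ψ h
    cases ψ <;> simp only [Formula.code, Nat.pair_eq_pair] at h <;> try omega
    rw [Encodable.encode_injective h.2.1, ih h.2.2]
  | next φ ih =>
    intro ψ h
    cases ψ <;> simp only [Formula.code, Nat.pair_eq_pair] at h <;> try omega
    rw [ih h.2]

instance [Countable P] : Countable (Formula P) := by
  have := Encodable.ofCountable P
  exact Formula.code_injective.countable

end Countability

/-! ### From inductive provability to countable derivations. -/

section Derivations

/-- `χ` is an axiom or the conclusion of a rule with premises in `D`. -/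
def Follows (D : Set (Formula P)) (χ : Formula P) : Prop :=
  IsAxiom χ ∨ ∃ Γ ⊆ D, IsRule Γ χ

open Classical in
/-- The sequence that keeps adding new formulas following from the previous ones, and is
constantly `d` when there are none left. -/
noncomputable def greedy (d : Formula P) (β : Ordinal.{0}) : Formula P :=
  let D : Set (Formula P) := Set.range fun γ : Set.Iio β => greedy d γ.1
  if h : ∃ χ, χ ∉ D ∧ Follows D χ then h.choose else d
termination_by β
decreasing_by exact γ.2

theorem greedy_spec (d : Formula P) (β : Ordinal.{0})
    (h : ∃ χ, χ ∉ greedy d '' Set.Iio β ∧ Follows (greedy d '' Set.Iio β) χ) :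
    greedy d β ∉ greedy d '' Set.Iio β ∧ Follows (greedy d '' Set.Iio β) (greedy d β) := by
  have key : greedy d β = h.choose := by
    have e : greedy d '' Set.Iio β = Set.range fun γ : Set.Iio β => greedy d γ.1 := by
      rw [Set.image_eq_range]
    conv_lhs => rw [greedy]
    simp only [e] at h ⊢
    rw [dif_pos h]
  rw [key]
  exact h.choose_spec

/-- Provability, as the least set of formulas closed under the axioms and rules. -/
inductive Provable : Formula P → Prop
  | ax {φ : Formula P} (h : IsAxiom φ) : Provable φ
  | rule {Γ : Set (Formula P)} {φ : Formula P} (h : IsRule Γ φ) (hΓ : ∀ ψ ∈ Γ, Provable ψ) :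
      Provable φ

/-- Let o be the first stage at which `greedy` finds nothing new. Entries before o are distinct, so
o is countable; they are closed under axioms and rules, so they include every provable formula. From
o on, φ is repeated, its premises being available. -/
theorem Provable.derivable [Countable P] {φ : Formula P} (hφ : Provable φ) : Derivable φ := by
  classical
  let s := greedy φ
  let New : Ordinal.{0} → Prop := fun β => ∃ χ, χ ∉ s '' Set.Iio β ∧ Follows (s '' Set.Iio β) χ
  have exhausted : ∃ β, ¬ New β := by
    by_contra! hall
    refine not_injective_of_ordinal s fun β γ e => ?_
    by_contra hne
    rcases lt_or_gt_of_ne hne with hlt | hlt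
    · exact (greedy_spec φ γ (hall γ)).1 ⟨β, hlt, e⟩
    · exact (greedy_spec φ β (hall β)).1 ⟨γ, hlt, e.symm⟩
  obtain ⟨o, ho, hmin⟩ : ∃ o, ¬ New o ∧ ∀ β < o, New β := by
    obtain ⟨o, ho, hmin⟩ := wellFounded_lt.has_min {β | ¬ New β} exhausted
    exact ⟨o, ho, fun β hβ => not_not.1 fun hn => hmin β hn hβ⟩
  have closed : ∀ χ, Follows (s '' Set.Iio o) χ → χ ∈ s '' Set.Iio o := by
    intro χ hχ
    by_contra hn
    exact ho ⟨χ, hn, hχ⟩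
  have all : ∀ χ : Formula P, Provable χ → χ ∈ s '' Set.Iio o := by
    intro χ hχ
    induction hχ with
    | ax h => exact closed _ (Or.inl h)
    | rule h _ ih => exact closed _ (Or.inr ⟨_, ih, h⟩)
  have inj : Set.InjOn s (Set.Iio o) := by
    intro β hβ γ hγ e
    by_contra hne
    rcases lt_or_gt_of_ne hne with hlt | hlt
    · exact (greedy_spec φ γ (hmin γ hγ)).1 ⟨β, hlt, e⟩
    · exact (greedy_spec φ β (hmin β hβ)).1 ⟨γ, hlt, e.symm⟩
  have cnt : (Set.Iio o).Countable :=
    Set.countable_of_injective_of_countable_image inj (Set.to_countable _)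
  have sub : ∀ β, s '' Set.Iio (min β o) ⊆
      (fun γ => if γ < o then s γ else φ) '' Set.Iio β := by
    rintro β _ ⟨γ, hγ, rfl⟩
    have hγ' := lt_min_iff.1 (Set.mem_Iio.1 hγ)
    exact ⟨γ, hγ'.1, if_pos hγ'.2⟩
  refine ⟨o, fun β => if β < o then s β else φ, ?_, ?_, ?_⟩
  · have := Cardinal.le_aleph0_iff_set_countable.2 cnt
    rw [Cardinal.mk_Iio_ordinal] at this
    rwa [Cardinal.lift_le_aleph0] at this
  · exact if_neg (not_lt.2 (le_self_add))
  · intro β _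
    by_cases hβ : β < o
    · simp only [if_pos hβ]
      rcases (greedy_spec φ β (hmin β hβ)).2 with h | ⟨Γ, hΓ, h⟩
      · exact Or.inl h
      · refine Or.inr ⟨Γ, hΓ.trans ?_, h⟩
        have := sub β
        rwa [min_eq_left hβ.le] at this
    · simp only [if_neg hβ]
      cases hφ with
      | ax h => exact Or.inl h
      | rule h hΓ =>
        refine Or.inr ⟨_, fun ψ hψ => ?_, h⟩
        have := sub β (a := ψ)
        rw [min_eq_right (not_lt.1 hβ)] at this
        exact this (all ψ (hΓ ψ hψ))

end Derivations

namespace Provable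

theorem taut {φ : Formula P} (h : IsTautology φ) : Provable φ := .ax (.taut φ h)

theorem mp {φ ψ : Formula P} (h : Provable (imp φ ψ)) (hφ : Provable φ) : Provable ψ :=
  .rule (.mp φ ψ) (by rintro χ (rfl | rfl) <;> assumption)

theorem nec_L {φ : Formula P} (h : Provable φ) : Provable (L 1 φ) :=
  .rule (.nec_L φ) (by rintro χ rfl; exact h)

theorem nec_next {φ : Formula P} (h : Provable φ) : Provable (next φ) :=
  .rule (.nec_next φ) (by rintro χ rfl; exact h)

theorem arch {n : ℕ} {r : Idx} {φ ψ : Formula P}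
    (h : ∀ s < r, Provable (imp ψ (nextIter n (L s φ)))) :
    Provable (imp ψ (nextIter n (L r φ))) :=
  .rule (.arch n r φ ψ) (by rintro χ ⟨s, hs, rfl⟩; exact h s hs)

/-- Propositional consequence from one premise. -/
theorem of_taut {φ ψ : Formula P} (h : Provable φ)
    (ht : ∀ e, propEval e φ → propEval e ψ) : Provable ψ :=
  mp (taut fun e => by have := ht e; simp only [imp, propEval]; tauto) h

/-- Propositional consequence from two premises. -/
theorem of_taut₂ {φ ψ χ : Formula P} (h : Provable φ) (h' : Provable ψ)
    (ht : ∀ e, propEval e φ → propEval e ψ → propEval e χ) : Provable χ :=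
  mp (of_taut (ψ := imp ψ χ) h fun e => by have := ht e; simp only [imp, propEval]; tauto) h'

end Provable

/-! ### Worlds and the canonical transition map. -/

/-- Maximal consistent sets of formulas that are saturated under the Archimedean rule. -/
@[ext] structure World (P : Type*) where
  carrier : Set (Formula P)
  of_provable : ∀ {φ}, Provable φ → φ ∈ carrier
  mp : ∀ {φ ψ}, imp φ ψ ∈ carrier → φ ∈ carrier → ψ ∈ carrier
  neg_mem : ∀ {φ}, neg φ ∈ carrier ↔ φ ∉ carrier
  arch : ∀ {n r φ}, (∀ s < r, nextIter n (L s φ) ∈ carrier) → nextIter n (L r φ) ∈ carrier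

namespace World

instance : Membership (Formula P) (World P) := ⟨fun w φ => φ ∈ w.carrier⟩

variable (w : World P)

theorem mem_of_provable {φ : Formula P} (h : Provable φ) : φ ∈ w := w.of_provable h

theorem neg_mem_iff {φ : Formula P} : neg φ ∈ w ↔ φ ∉ w := w.neg_mem

theorem and_mem_iff {φ ψ : Formula P} : and φ ψ ∈ w ↔ φ ∈ w ∧ ψ ∈ w := by
  refine ⟨fun h => ⟨w.mp (w.of_provable (.taut ?_)) h, w.mp (w.of_provable (.taut ?_)) h⟩,
    fun h => w.mp (w.mp (w.of_provable (.taut ?_)) h.1) h.2⟩ <;>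
  · intro e
    simp only [imp, propEval]
    tauto

theorem imp_mem_iff {φ ψ : Formula P} : imp φ ψ ∈ w ↔ (φ ∈ w → ψ ∈ w) := by
  simp only [imp, neg_mem_iff, and_mem_iff]
  tauto

theorem iff_mem_iff {φ ψ : Formula P} : Formula.iff φ ψ ∈ w ↔ (φ ∈ w ↔ ψ ∈ w) := by
  simp only [Formula.iff, and_mem_iff, imp_mem_iff]
  tauto

theorem next_neg_mem_iff {φ : Formula P} : next (neg φ) ∈ w ↔ next φ ∉ w := by
  rw [← neg_mem_iff, ← iff_mem_iff]
  exact w.mem_of_provable (.ax (.func_next φ))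

theorem next_and_mem_iff {φ ψ : Formula P} :
    next (and φ ψ) ∈ w ↔ next φ ∈ w ∧ next ψ ∈ w := by
  rw [← and_mem_iff, ← iff_mem_iff]
  exact w.mem_of_provable (.ax (.conj_next φ ψ))

/-- The successor of a world under the canonical transition map. -/
def succ : World P where
  carrier := {φ | next φ ∈ w}
  of_provable h := w.mem_of_provable h.nec_next
  mp {φ ψ} h hφ := by
    simp only [Set.mem_ofPred_eq, imp, next_neg_mem_iff, next_and_mem_iff] at *
    tauto
  neg_mem := w.next_neg_mem_iff
  arch {n r φ} h := by
    -- The prefix ○ⁿ in the Archimedean rule is what lets saturation pass to the successor.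
    have := w.arch (n := n + 1) (r := r) (φ := φ)
    simp only [nextIter, Function.iterate_succ_apply'] at this
    exact this h

theorem mem_succ {φ : Formula P} : φ ∈ w.succ ↔ next φ ∈ w := Iff.rfl

end World

/-! ### Existence of worlds (Rasiowa–Sikorski). -/

section Existence

/-- The consistent formulas. -/
abbrev Consistent (P : Type*) : Type _ := {φ : Formula P // ¬ Provable (neg φ)}

/-- Larger means logically stronger, so that ideals generate filters of formulas. -/
instance : Preorder {φ : Formula P // ¬ Provable (neg φ)} where
  le a b := Provable (imp b.1 a.1)
  le_refl a := .taut fun e => by simp only [imp, propEval]; tauto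
  le_trans a b c h h' := .of_taut₂ h h' fun e => by simp only [imp, propEval]; tauto

theorem Consistent.exists_le_of_not_provable (a : Consistent P) {χ : Formula P}
    (h : ¬ Provable (imp a.1 χ)) : ∃ b, a ≤ b ∧ Provable (imp b.1 (neg χ)) :=
  -- `imp` unfolds to a negated conjunction, so `h` itself is the consistency of a ∧ ¬χ.
  ⟨⟨and a.1 (neg χ), h⟩, .taut fun e => by simp only [imp, propEval]; tauto,
    .taut fun e => by simp only [imp, propEval]; tauto⟩

/-- The formulas that decide `χ`. -/
def decideCofinal (χ : Formula P) : Order.Cofinal (Consistent P) where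
  carrier := {a | Provable (imp a.1 χ) ∨ Provable (imp a.1 (neg χ))}
  isCofinal a := by
    by_cases h : Provable (imp a.1 χ)
    · exact ⟨a, Or.inl h, le_rfl⟩
    · obtain ⟨b, hab, hb⟩ := a.exists_le_of_not_provable h
      exact ⟨b, Or.inr hb, hab⟩

/-- The formulas that respect an instance of the Archimedean rule. -/
def archCofinal (i : ℕ × Idx × Formula P) : Order.Cofinal (Consistent P) where
  carrier := {a | Provable (imp a.1 (nextIter i.1 (L i.2.1 i.2.2))) ∨
    ∃ s < i.2.1, Provable (imp a.1 (neg (nextIter i.1 (L s i.2.2))))}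
  isCofinal a := by
    by_cases h : ∀ s < i.2.1, Provable (imp a.1 (nextIter i.1 (L s i.2.2)))
    -- The rule is applied with the formula a as its antecedent ψ.
    · exact ⟨a, Or.inl (.arch h), le_rfl⟩
    · push Not at h
      obtain ⟨s, hs, h⟩ := h
      obtain ⟨b, hab, hb⟩ := a.exists_le_of_not_provable h
      exact ⟨b, Or.inr ⟨s, hs, hb⟩, hab⟩

variable [Countable P]

/-- Every consistent formula belongs to a world. -/
theorem exists_world_mem {φ : Formula P} (hφ : ¬ Provable (neg φ)) : ∃ w : World P, φ ∈ w := by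
  have := Encodable.ofCountable (Formula P ⊕ ℕ × Idx × Formula P)
  let 𝒟 : Formula P ⊕ ℕ × Idx × Formula P → Order.Cofinal (Consistent P) :=
    Sum.elim decideCofinal archCofinal
  let I := Order.idealOfCofinals (⟨φ, hφ⟩ : Consistent P) 𝒟
  have mem : ∀ i, ∃ a ∈ 𝒟 i, a ∈ I := fun i => by
    simpa [and_comm] using Order.cofinal_meets_idealOfCofinals (⟨φ, hφ⟩ : Consistent P) 𝒟 i
  let C : Set (Formula P) := {χ | ∃ a ∈ I, Provable (imp a.1 χ)}
  have two : ∀ {χ ψ θ : Formula P}, χ ∈ C → ψ ∈ C →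
      (∀ e, propEval e χ → propEval e ψ → propEval e θ) → θ ∈ C := by
    rintro χ ψ θ ⟨a, ha, h⟩ ⟨b, hb, h'⟩ ht
    obtain ⟨c, hc, hac, hbc⟩ := I.directed a ha b hb
    have h₁ : Provable (imp c.1 χ) :=
      .of_taut₂ hac h fun e => by simp only [imp, propEval]; tauto
    have h₂ : Provable (imp c.1 ψ) :=
      .of_taut₂ hbc h' fun e => by simp only [imp, propEval]; tauto
    exact ⟨c, hc, .of_taut₂ h₁ h₂ fun e => by
      have := ht e
      simp only [imp, propEval]
      tauto⟩
  have consistent : ∀ {χ : Formula P}, χ ∈ C → neg χ ∉ C := by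
    intro χ h h'
    obtain ⟨a, -, ha⟩ : and χ (neg χ) ∈ C := two h h' fun e => by
      simp only [propEval]; tauto
    exact a.2 (.of_taut ha fun e => by simp only [imp, propEval]; tauto)
  refine ⟨⟨C, ?_, ?_, ?_, ?_⟩, ⟨φ, hφ⟩, Order.mem_idealOfCofinals _ _,
    .taut fun e => by simp only [imp, propEval]; tauto⟩
  · intro χ h
    exact ⟨⟨φ, hφ⟩, Order.mem_idealOfCofinals _ _,
      .of_taut h fun e => by simp only [imp, propEval]; tauto⟩
  · intro χ ψ h h'
    exact two h h' fun e => by simp only [imp, propEval]; tauto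
  · intro χ
    refine ⟨fun h h' => consistent h' h, fun h => ?_⟩
    obtain ⟨a, ha | ha, haI⟩ := mem (.inl χ)
    · exact absurd ⟨a, haI, ha⟩ h
    · exact ⟨a, haI, ha⟩
  · intro n r χ h
    obtain ⟨a, ha | ⟨s, hs, ha⟩, haI⟩ := mem (.inr (n, r, χ))
    · exact ⟨a, haI, ha⟩
    · exact absurd ⟨a, haI, ha⟩ (consistent (h s hs))

theorem provable_of_forall_world {φ : Formula P} (h : ∀ w : World P, φ ∈ w) : Provable φ := by
  by_contra hn
  obtain ⟨w, hw⟩ := exists_world_mem (φ := neg φ) fun h' =>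
    hn (h'.of_taut fun e => by simp only [propEval]; tauto)
  exact w.neg_mem_iff.1 hw (h w)

end Existence

namespace World

/-! ### Probabilities at a world and their realisation by measures. -/

section Probability

variable (w : World P)

theorem L_add_mem {r s : Idx} {φ ψ : Formula P} (h : (r : ℚ) + s ≤ 1)
    (hr : L r (and φ ψ) ∈ w) (hs : L s (and φ (neg ψ)) ∈ w) : L (Idx.add r s h) φ ∈ w := by
  have := w.mem_of_provable (.ax (.fa₃ r s φ ψ h))
  rw [imp_mem_iff, and_mem_iff] at this
  exact this ⟨hr, hs⟩

theorem L_add_notMem {r s : Idx} {φ ψ : Formula P} (h : (r : ℚ) + s ≤ 1)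
    (hr : L r (and φ ψ) ∉ w) (hs : L s (and φ (neg ψ)) ∉ w) : L (Idx.add r s h) φ ∉ w := by
  have := w.mem_of_provable (.ax (.fa₄ r s φ ψ h))
  simp only [imp_mem_iff, and_mem_iff, neg_mem_iff] at this
  exact this ⟨hr, hs⟩

/-- The probability that the world `w` assigns to `φ`. -/
noncomputable def prob (φ : Formula P) : ℝ :=
  sSup ((fun r : Idx => ((r : ℚ) : ℝ)) '' {r | L r φ ∈ w})

theorem bddAbove_prob (φ : Formula P) :
    BddAbove ((fun r : Idx => ((r : ℚ) : ℝ)) '' {r | L r φ ∈ w}) :=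
  ⟨1, by rintro _ ⟨r, -, rfl⟩; simpa using Rat.cast_le (K := ℝ) |>.2 r.2.2⟩

theorem le_prob {r : Idx} {φ : Formula P} (h : L r φ ∈ w) : ((r : ℚ) : ℝ) ≤ w.prob φ :=
  le_csSup (w.bddAbove_prob φ) ⟨r, h, rfl⟩

variable [Countable P]

theorem L_one_mem {φ : Formula P} (h : ∀ x : World P, φ ∈ x) : L 1 φ ∈ w :=
  w.mem_of_provable (provable_of_forall_world h).nec_L

theorem L_mem_of_imp {r : Idx} {φ ψ : Formula P} (h : ∀ x : World P, φ ∈ x → ψ ∈ x)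
    (hr : L r φ ∈ w) : L r ψ ∈ w := by
  have := w.mem_of_provable (.ax (.mono r φ ψ))
  simp only [imp_mem_iff] at this
  exact this (w.L_one_mem fun x => x.imp_mem_iff.2 (h x)) hr

theorem L_zero_mem (φ : Formula P) : L 0 φ ∈ w := by
  -- Writing ⊥ requires a variable; φ contains one.
  obtain ⟨p⟩ : Nonempty P := by
    induction φ with
    | var p => exact ⟨p⟩
    | _ => assumption
  refine w.L_mem_of_imp (fun x hx => ?_) (w.mem_of_provable (.ax (.fa₁ p)))
  simp only [bot, and_mem_iff, neg_mem_iff] at hx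
  exact absurd hx.1 hx.2

theorem add_le_one_of_disjoint {r s : Idx} {φ ψ : Formula P}
    (h : ∀ x : World P, φ ∈ x → ψ ∉ x) (hr : L r φ ∈ w) (hs : L s ψ ∈ w) :
    (r : ℚ) + s ≤ 1 := by
  by_contra! hn
  have := w.mem_of_provable (.ax (.fa₂ r s ψ hn))
  rw [imp_mem_iff, neg_mem_iff] at this
  exact this (w.L_mem_of_imp (fun x hx => x.neg_mem_iff.2 (h x hx)) hr) hs

/-- Write r = s + t and apply `fa₄` to φ ∧ φ and φ ∧ ¬φ; the latter cannot have probability at least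
t > 0, as its negation has probability 1. -/
theorem L_mem_of_le {r s : Idx} {φ : Formula P} (hsr : s ≤ r) (hr : L r φ ∈ w) :
    L s φ ∈ w := by
  rcases hsr.eq_or_lt with rfl | hlt
  · exact hr
  have hlt' : (s : ℚ) < r := hlt
  let t : Idx := ⟨r - s, by linarith, by linarith [r.2.2, s.2.1]⟩
  have hst : (s : ℚ) + t ≤ 1 := by simpa [t] using r.2.2
  have hadd : Idx.add s t hst = r := Subtype.ext (by simp [Idx.add, t])
  by_contra hn
  refine w.L_add_notMem (ψ := φ) hst (fun h => hn (w.L_mem_of_imp ?_ h)) (fun h => ?_)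
    (hadd.symm ▸ hr)
  · intro x hx
    exact (x.and_mem_iff.1 hx).1
  · have h1 := w.add_le_one_of_disjoint (r := 1) (φ := neg (and φ (neg φ)))
      (fun x hx => x.neg_mem_iff.1 hx) (w.L_one_mem fun x => ?_) h
    · simp only [Set.Icc.coe_one, t] at h1
      linarith
    · simp only [neg_mem_iff, and_mem_iff]
      tauto

theorem prob_le {φ : Formula P} {a : ℝ} (h : ∀ r : Idx, L r φ ∈ w → ((r : ℚ) : ℝ) ≤ a) :
    w.prob φ ≤ a :=
  csSup_le ⟨_, 0, w.L_zero_mem φ, rfl⟩ (by rintro _ ⟨r, hr, rfl⟩; exact h r hr)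

theorem L_mem_of_lt_prob {r : Idx} {φ : Formula P} (h : ((r : ℚ) : ℝ) < w.prob φ) :
    L r φ ∈ w := by
  by_contra hn
  refine h.not_ge (w.prob_le fun s hs => ?_)
  by_contra! hlt
  exact hn (w.L_mem_of_le (show r ≤ s from by exact_mod_cast hlt.le) hs)

/-- Archimedean saturation with n = 0 says that the supremum is attained when rational. -/
theorem L_mem_iff {r : Idx} {φ : Formula P} : L r φ ∈ w ↔ ((r : ℚ) : ℝ) ≤ w.prob φ := by
  refine ⟨w.le_prob, fun h => w.arch (n := 0) fun s hs => w.L_mem_of_lt_prob ?_⟩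
  exact lt_of_lt_of_le (by exact_mod_cast hs) h

theorem prob_nonneg (φ : Formula P) : 0 ≤ w.prob φ := by
  simpa using w.le_prob (w.L_zero_mem φ)

theorem prob_le_one (φ : Formula P) : w.prob φ ≤ 1 :=
  w.prob_le fun r _ => by exact_mod_cast r.2.2

theorem prob_eq_one {φ : Formula P} (h : ∀ x : World P, φ ∈ x) : w.prob φ = 1 :=
  (w.prob_le_one φ).antisymm (by simpa using w.le_prob (w.L_one_mem h))

theorem prob_mono {φ ψ : Formula P} (h : ∀ x : World P, φ ∈ x → ψ ∈ x) :
    w.prob φ ≤ w.prob ψ :=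
  w.prob_le fun _ hr => w.le_prob (w.L_mem_of_imp h hr)

theorem prob_congr {φ ψ : Formula P} (h : ∀ x : World P, φ ∈ x ↔ ψ ∈ x) :
    w.prob φ = w.prob ψ :=
  (w.prob_mono fun x => (h x).1).antisymm (w.prob_mono fun x => (h x).2)

theorem prob_and_add_prob_and_neg (φ ψ : Formula P) :
    w.prob (and φ ψ) + w.prob (and φ (neg ψ)) = w.prob φ := by
  apply le_antisymm
  · have key : ∀ r s : Idx, L r (and φ ψ) ∈ w → L s (and φ (neg ψ)) ∈ w →
        ((r : ℚ) : ℝ) + ((s : ℚ) : ℝ) ≤ w.prob φ := by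
      intro r s hr hs
      have hrs : (r : ℚ) + s ≤ 1 := w.add_le_one_of_disjoint (fun x hx => by
        simp only [and_mem_iff, neg_mem_iff] at hx ⊢
        tauto) hr hs
      simpa [Idx.add] using w.le_prob (w.L_add_mem hrs hr hs)
    rw [← le_sub_iff_add_le]
    refine w.prob_le fun r hr => ?_
    rw [le_sub_comm]
    refine w.prob_le fun s hs => ?_
    linarith [key r s hr hs]
  · by_contra! hlt
    have h1 := w.prob_le_one φ
    have h2 := w.prob_nonneg (and φ ψ)
    have h3 := w.prob_nonneg (and φ (neg ψ))
    -- Choose r and s strictly above the two parts with r + s still below the whole; this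
    -- contradicts `fa₄`.
    obtain ⟨r, hr, hr'⟩ := exists_rat_btwn
      (show w.prob (and φ ψ) < w.prob φ - w.prob (and φ (neg ψ)) by linarith)
    obtain ⟨s, hs, hs'⟩ := exists_rat_btwn
      (show w.prob (and φ (neg ψ)) < w.prob φ - r by linarith)
    have r0 : 0 ≤ r := by exact_mod_cast h2.trans hr.le
    have s0 : 0 ≤ s := by exact_mod_cast h3.trans hs.le
    have hrs : r + s ≤ 1 := by
      have : (r : ℝ) + s ≤ 1 := by linarith
      exact_mod_cast this
    refine w.L_add_notMem (r := ⟨r, r0, by linarith⟩) (s := ⟨s, s0, by linarith⟩)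
      (φ := φ) (ψ := ψ) hrs (fun h => ?_) (fun h => ?_) (w.L_mem_of_lt_prob ?_)
    · exact hr.not_ge (w.le_prob h)
    · exact hs.not_ge (w.le_prob h)
    · simp only [Idx.add, Rat.cast_add]
      linarith

theorem prob_eq_zero {φ : Formula P} (h : ∀ x : World P, φ ∉ x) : w.prob φ = 0 := by
  have h1 := w.prob_and_add_prob_and_neg φ φ
  -- For unsatisfiable φ, additivity reads 2p = p.
  rw [w.prob_congr (φ := and φ φ) (ψ := φ) fun x => by simp [and_mem_iff],
    w.prob_congr (φ := and φ (neg φ)) (ψ := φ) fun x => by simp [and_mem_iff, h x]] at h1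
  linarith

instance : MeasurableSpace (World P) := ⊤

/-- On finitely many formulas, the probabilities at a world, relative to `θ`, are those of a
measure on worlds. -/
theorem exists_measure_relative (S : List (Formula P)) (θ : Formula P) :
    ∃ ν : Measure (World P), ν Set.univ = ENNReal.ofReal (w.prob θ) ∧ ν {x | θ ∉ x} = 0 ∧
      ∀ χ ∈ S, ν {x | χ ∈ x} = ENNReal.ofReal (w.prob (and θ χ)) := by
  induction S generalizing θ with
  | nil =>
    by_cases h : ∃ x : World P, θ ∈ x
    · obtain ⟨x, hx⟩ := h
      refine ⟨ENNReal.ofReal (w.prob θ) • Measure.dirac x, by simp, ?_, by simp⟩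
      rw [Measure.smul_apply, Measure.dirac_apply' _ MeasurableSpace.measurableSet_top]
      simp [hx]
    · push Not at h
      exact ⟨0, by simp [w.prob_eq_zero h], by simp, by simp⟩
  | cons ψ S ih =>
    -- Split θ along ψ and add the two measures; the null-set clause keeps each on its own side of
    -- ψ.
    obtain ⟨ν₁, u₁, z₁, h₁⟩ := ih (and θ ψ)
    obtain ⟨ν₂, u₂, z₂, h₂⟩ := ih (and θ (neg ψ))
    have nn := w.prob_nonneg
    refine ⟨ν₁ + ν₂, ?_, ?_, ?_⟩
    · rw [Measure.add_apply, u₁, u₂, ← ENNReal.ofReal_add (nn _) (nn _),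
        prob_and_add_prob_and_neg]
    · rw [Measure.add_apply, measure_mono_null _ z₁, measure_mono_null _ z₂, add_zero] <;>
      · intro x hx
        simp only [Set.mem_ofPred_eq, and_mem_iff] at hx ⊢
        tauto
    · intro χ hχ
      rcases List.mem_cons.1 hχ with rfl | hχ
      · have e₁ : ν₁ {x | χ ∈ x} = ν₁ Set.univ := by
          refine measure_congr (ae_eq_univ.2 (measure_mono_null ?_ z₁))
          intro x hx
          simp only [Set.mem_compl_iff, Set.mem_ofPred_eq, and_mem_iff] at hx ⊢
          tauto
        have e₂ : ν₂ {x | χ ∈ x} = 0 := by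
          refine measure_mono_null ?_ z₂
          intro x hx
          simp only [Set.mem_ofPred_eq, and_mem_iff, neg_mem_iff] at hx ⊢
          tauto
        rw [Measure.add_apply, e₁, e₂, u₁, add_zero]
      · rw [Measure.add_apply, h₁ χ hχ, h₂ χ hχ, ← ENNReal.ofReal_add (nn _) (nn _),
          ← w.prob_and_add_prob_and_neg (and θ χ) ψ]
        congr 2 <;>
        · refine w.prob_congr fun x => ?_
          simp only [and_mem_iff, neg_mem_iff]
          tauto

theorem exists_probabilityMeasure (S : List (Formula P)) :
    ∃ ν : Measure (World P), IsProbabilityMeasure ν ∧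
      ∀ χ ∈ S, ν.real {x | χ ∈ x} = w.prob χ := by
  cases S with
  -- Without a formula at hand no tautology can be formed to serve as θ; any probability measure
  -- will do.
  | nil => exact ⟨Measure.dirac w, inferInstance, by simp⟩
  | cons ψ S =>
    have top : ∀ x : World P, neg (and ψ (neg ψ)) ∈ x := fun x => by
      simp only [neg_mem_iff, and_mem_iff]
      tauto
    obtain ⟨ν, hu, -, hν⟩ := w.exists_measure_relative (ψ :: S) (neg (and ψ (neg ψ)))
    refine ⟨ν, ⟨by rw [hu, w.prob_eq_one top, ENNReal.ofReal_one]⟩, fun χ hχ => ?_⟩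
    rw [measureReal_def, hν χ hχ, ENNReal.toReal_ofReal (w.prob_nonneg _)]
    exact w.prob_congr fun x => by simp [and_mem_iff, top x]

end Probability

end World

/-! ### The canonical model for finitely many probed formulas. -/

section CanonicalModel

/-- The formulas whose probability is mentioned in a formula. -/
def Formula.probed : Formula P → List (Formula P)
  | .var _ => []
  | .neg φ => φ.probed
  | .and φ ψ => φ.probed ++ ψ.probed
  | .L _ φ => φ :: φ.probed
  | .next φ => φ.probed

/-- Validity quantifies over spaces in universe v, so the worlds must be moved there. -/
instance [Countable P] : Small.{v} (World P) :=
  small_of_injective (β := Set (Formula P)) (f := World.carrier) fun _ _ => World.ext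

variable [Countable P]

/-- A measure on worlds that agrees with the probabilities at `w` of the formulas in `S`. -/
noncomputable def worldMeasure (S : List (Formula P)) (w : World P) : Measure (World P) :=
  (w.exists_probabilityMeasure S).choose

theorem isProbabilityMeasure_worldMeasure (S : List (Formula P)) (w : World P) :
    IsProbabilityMeasure (worldMeasure S w) :=
  (w.exists_probabilityMeasure S).choose_spec.1

theorem worldMeasure_real {S : List (Formula P)} (w : World P) {χ : Formula P} (h : χ ∈ S) :
    (worldMeasure S w).real {x | χ ∈ x} = w.prob χ :=
  (w.exists_probabilityMeasure S).choose_spec.2 χ h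

instance : MeasurableSpace (Shrink.{v} (World P)) := ⊤

/-- The canonical model, whose kernel is correct for the formulas in `S`. -/
noncomputable def canonicalModel (S : List (Formula P)) :
    DynamicMarkovModel P (Shrink.{v} (World P)) where
  process :=
    { T := ⟨fun w => (worldMeasure S ((equivShrink _).symm w)).map (equivShrink _),
        measurable_from_top⟩
      isMarkovKernel := ⟨fun w => by
        have := isProbabilityMeasure_worldMeasure S ((equivShrink _).symm w)
        exact Measure.isProbabilityMeasure_map measurable_from_top.aemeasurable⟩
      f := fun w => equivShrink _ ((equivShrink _).symm w).succ
      measurable_f := measurable_from_top }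
  v p := {w | var p ∈ (equivShrink _).symm w}
  measurableSet_v _ := trivial

/-- Truth lemma. In the `L` case the truth set is, by induction, the set of worlds containing a
formula of S, whose measure is its probability. -/
theorem sat_canonicalModel_iff (S : List (Formula P)) (φ : Formula P) (hφ : φ.probed ⊆ S)
    (w : Shrink.{v} (World P)) :
    Sat (canonicalModel S) φ w ↔ φ ∈ (equivShrink _).symm w := by
  induction φ generalizing w with
  | var p => exact Iff.rfl
  | neg φ ih => rw [World.neg_mem_iff, ← ih hφ]; exact Iff.rfl
  | and φ ψ ih₁ ih₂ =>
    rw [World.and_mem_iff, ← ih₁ (List.append_subset.1 hφ).1, ← ih₂ (List.append_subset.1 hφ).2]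
    exact Iff.rfl
  | next φ ih =>
    rw [← World.mem_succ, ← Equiv.symm_apply_apply (equivShrink (World P)) (World.succ _),
      ← ih hφ]
    exact Iff.rfl
  | L r φ ih =>
    have h := List.cons_subset.1 hφ
    rw [World.L_mem_iff, ← worldMeasure_real _ h.1]
    have key : ((canonicalModel S).process.T w).real {x | Sat (canonicalModel S) φ x} =
        (worldMeasure S ((equivShrink _).symm w)).real {x | φ ∈ x} := by
      change ((worldMeasure S ((equivShrink _).symm w)).map (equivShrink _)).real _ = _
      rw [measureReal_def, Measure.map_apply measurable_from_top MeasurableSpace.measurableSet_top, measureReal_def]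
      congr 2
      ext x
      simp [ih h.2]
    rw [← key]
    exact Iff.rfl

end CanonicalModel

end DPL

theorem theorem2 {P : Type u} [Countable P] (φ : DPL.Formula P)
    (h : DPL.Valid.{u, v} φ) : DPL.Derivable φ := by
  refine (DPL.provable_of_forall_world fun w => ?_).derivable
  have := h _ _ (DPL.canonicalModel φ.probed) rfl (equivShrink _ w)
  rw [DPL.sat_canonicalModel_iff _ _ (List.Subset.refl _)] at this
  simpa using this
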